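/- Let $G$ be a Hausdorff, locally compact, second countable, unimodular topological group with centre $Z$, let $X=G/Z$ with canonical projection $p:G\to X$, let $s:X\to G$ be a Borel section of $p$, let $\mu$ be a Haar measure on $G$ and $\alpha$ a Haar measure on $X$. Scalar products are antilinear in the first variable. Let $(\pi,\mathcal H)$ be a continuous irreducible unitary representation of $G$ on a complex separable Hilbert space, with central character $\chi:Z\to\mathbb T$ (so $\pi(h)=\chi(h)I$ for $h\in Z$). Put $c_{u,v}(g)=\langle \pi(g)u,v\rangle$ for $u,v\in\mathcal H$, and assume that $\pi$ is square integrable modulo the centre, i.e. $c_{u,v}\circ s\in L^2(X,\alpha)$ for all $u,v\in\mathcal H$. Assume that $\alpha$ is normalised so that $\pi$ has formal degree $1$, i.e. $\int_X |c_{u,v}(s(x))|^2\,d\alpha(x)=1$ for some unit vectors $u,v$ (the value of this integral does not depend on the choice of the unit vectors, so this can always be achieved by rescaling $\alpha$). Let $\mathcal H^\chi$ be the Hilbert space of $\mu$-equivalence classes of measurable functions $f:G\to\mathbb C$ such that $f(gh)=\chi(h^{-1})f(g)$ for all $g\in G$, $h\in Z$, and $f\circ s\in L^2(X,\alpha)$,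 with scalar product $\langle f_1,f_2\rangle=\int_X\overline{f_1(s(x))}f_2(s(x))\,d\alpha(x)$, and let $l$ be the representation of $G$ on $\mathcal H^\chi$ induced by $\chi$, $(l(a)f)(g)=f(a^{-1}g)$. For $u\in\mathcal H$ let $W_u:\mathcal H\to\mathcal H^\chi$ be the bounded operator $W_uv=c_{u,v}$. Let $\{e_i\}$ be an orthonormal basis of $\mathcal H$. Then every $W_{e_i}W_{e_i}^*$ is an orthogonal projection in $\mathcal H^\chi$, and the family $\{W_{e_i}W_{e_i}^*\}$ is a resolution of the identity in $\mathcal H^\chi$ (the projections are mutually orthogonal and sum strongly to the identity) if and only if $(l,\mathcal H^\chi)$ is isotypic, i.e. is a Hilbert direct sum of copies of one irreducible continuous unitary representation of $G$. -/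

import Mathlib

open MeasureTheory Filter
open scoped ENNReal Topology ComplexConjugate

set_option linter.unusedSectionVars false

noncomputable section

namespace PhaseSpace

/-! ### Unitary representations -/

section Rep

universe w

variable {G : Type*} [Group G]

/-- (Strong) continuity of a unitary representation of `G`. -/
def IsContinuousRep [TopologicalSpace G] {H : Type*} [NormedAddCommGroup H]
    [InnerProductSpace ℂ H] (ρ : G →* (H ≃ₗᵢ[ℂ] H)) : Prop :=
  ∀ v : H, Continuous fun g => ρ g v

/-- Irreducibility of a unitary representation: the space is non-zero and the only closed
invariant subspaces are the trivial ones. -/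
def IsIrreducibleRep {H : Type*} [NormedAddCommGroup H] [InnerProductSpace ℂ H]
    (ρ : G →* (H ≃ₗᵢ[ℂ] H)) : Prop :=
  Nontrivial H ∧ ∀ V : Submodule ℂ H, IsClosed (V : Set H) →
    (∀ g, ∀ v ∈ V, ρ g v ∈ V) → V = ⊥ ∨ V = ⊤

/-- A unitary representation `ρ` on a Hilbert space `H` is isotypic if it is the (Hilbert) direct
sum of copies of one irreducible continuous unitary representation `σ`. The copies are given by
isometric intertwining operators `T i` from `σ` to `ρ`. -/
def IsIsotypicRep [TopologicalSpace G] {H : Type w} [NormedAddCommGroup H]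
    [InnerProductSpace ℂ H] [CompleteSpace H] (ρ : G →* (H ≃ₗᵢ[ℂ] H)) : Prop :=
  ∃ (K : Type w) (_ : NormedAddCommGroup K) (_ : InnerProductSpace ℂ K) (_ : CompleteSpace K)
    (σ : G →* (K ≃ₗᵢ[ℂ] K)) (ι : Type w) (T : ι → K →ₗᵢ[ℂ] H),
    IsContinuousRep σ ∧ IsIrreducibleRep σ ∧
    (∀ i g v, T i (σ g v) = ρ g (T i v)) ∧
    IsHilbertSum ℂ (fun _ : ι => K) T

/-- A family of operators on a Hilbert space is a resolution of the identity by projections: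
orthogonal projections, mutually orthogonal, summing strongly to the identity. -/
def IsResolutionOfIdentity {ι : Type*} {H : Type*} [NormedAddCommGroup H]
    [InnerProductSpace ℂ H] [CompleteSpace H] (P : ι → H →L[ℂ] H) : Prop :=
  (∀ i, IsStarProjection (P i)) ∧ (∀ i j, i ≠ j → P i * P j = 0) ∧
    ∀ f : H, HasSum (fun i => P i f) f

end Rep

/-! ### Sections, central characters, coefficients -/

section Basic

variable (G : Type*) [Group G] [MeasurableSpace G]

/-- A Borel section `s : G/Z → G` of the canonical projection, `Z` the centre of `G`. -/
structure BorelSection where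
  toFun : G ⧸ Subgroup.center G → G
  measurable : Measurable toFun
  mk_apply : ∀ x, (QuotientGroup.mk (toFun x) : G ⧸ Subgroup.center G) = x

instance : CoeFun (BorelSection G) (fun _ => G ⧸ Subgroup.center G → G) := ⟨BorelSection.toFun⟩

end Basic

section Coeff

variable {G : Type*} [Group G] [TopologicalSpace G]
  {H : Type*} [NormedAddCommGroup H] [InnerProductSpace ℂ H]

/-- `χ` is the central character of `π`: `π h = χ h • 1` for `h` in the centre. -/
def IsCentralCharacter (π : G →* (H ≃ₗᵢ[ℂ] H)) (χ : Subgroup.center G →ₜ* Circle) : Prop :=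
  ∀ (h : Subgroup.center G) (v : H), π (h : G) v = (χ h : ℂ) • v

/-- The coefficient `c_{u,v}(g) = ⟨π(g) u, v⟩` (antilinear in the first slot). -/
def coeff (π : G →* (H ≃ₗᵢ[ℂ] H)) (u v : H) (g : G) : ℂ := inner ℂ (π g u) v

/-- Square integrability modulo the centre: `c_{u,v} ∘ s ∈ L²(G/Z, α)` for all `u`, `v`. -/
def IsSquareIntegrableModCenter [MeasurableSpace G] (α : Measure (G ⧸ Subgroup.center G))
    (s : BorelSection G) (π : G →* (H ≃ₗᵢ[ℂ] H)) : Prop :=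
  ∀ u v : H, MemLp (fun x => coeff π u v (s x)) 2 α

/-- The Haar measure `α` is normalised so that the formal degree of `π` is one, that is, so that
`‖c_{u,v}‖² = ‖u‖² ‖v‖²` for the coefficients of `π`. (By the orthogonality relations,
`‖c_{u,v}‖² / (‖u‖² ‖v‖²)` does not depend on `u, v ≠ 0`, so one pair of unit vectors fixes it.) -/
def HasFormalDegreeOne [MeasurableSpace G] (α : Measure (G ⧸ Subgroup.center G))
    (s : BorelSection G) (π : G →* (H ≃ₗᵢ[ℂ] H)) : Prop :=
  ∃ u v : H, ‖u‖ = 1 ∧ ‖v‖ = 1 ∧ ∫ x, ‖coeff π u v (s x)‖ ^ 2 ∂α = 1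

end Coeff

/-! ### The induced representation -/

section Induced

variable {G : Type*} [Group G] [TopologicalSpace G] [IsTopologicalGroup G]
  [LocallyCompactSpace G] [SecondCountableTopology G] [MeasurableSpace G] [BorelSpace G]

theorem measurable_mk_mul (a : G) : Measurable
    fun x : G ⧸ Subgroup.center G => (QuotientGroup.mk a : G ⧸ Subgroup.center G) * x := by
  refine measurable_from_quotient.2 ?_
  have hmk : Measurable (QuotientGroup.mk : G → G ⧸ Subgroup.center G) :=
    measurable_from_quotient.1 measurable_id
  exact hmk.comp (measurable_const_mul a)

theorem measurePreserving_mk_mul (α : Measure (G ⧸ Subgroup.center G)) [α.IsHaarMeasure]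
    (a : G) : MeasurePreserving
    (fun x : G ⧸ Subgroup.center G => (QuotientGroup.mk a : G ⧸ Subgroup.center G) * x) α α :=
  ⟨measurable_mk_mul a, Measure.IsMulLeftInvariant.map_mul_left_eq_self _⟩

/-- A set in `G/Z` is `α`-null iff its preimage in `G` is `μ`-null. -/
theorem ae_mk_iff (μ : Measure G) [μ.IsHaarMeasure] [μ.IsMulRightInvariant]
    (α : Measure (G ⧸ Subgroup.center G)) [α.IsHaarMeasure] (s : BorelSection G)
    {p : G ⧸ Subgroup.center G → Prop} (hp : MeasurableSet {x | p x}) :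
    (∀ᵐ g ∂μ, p (QuotientGroup.mk g)) ↔ ∀ᵐ x ∂α, p x := by
  have hmk : Measurable (QuotientGroup.mk : G → G ⧸ Subgroup.center G) :=
    measurable_from_quotient.1 measurable_id
  set q : G × (G ⧸ Subgroup.center G) → G ⧸ Subgroup.center G :=
    fun y => QuotientGroup.mk (y.1 * s y.2) with hq
  have hqm : Measurable q :=
    hmk.comp (measurable_fst.mul (s.measurable.comp measurable_snd))
  have hE : MeasurableSet {y | p (q y)} := hqm hp
  have hq' : ∀ g x, q (g, x) = (QuotientGroup.mk g : G ⧸ Subgroup.center G) * x := by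
    intro g x
    simp [hq, s.mk_apply]
  have h1 : (∀ᵐ y ∂μ.prod α, p (q y)) ↔ ∀ᵐ x ∂α, p x := by
    rw [Measure.ae_prod_iff_ae_ae hE]
    have : ∀ g : G, (∀ᵐ x ∂α, p (q (g, x))) ↔ ∀ᵐ x ∂α, p x := by
      intro g
      simp only [hq']
      constructor
      · intro h
        have h' := (measurePreserving_mk_mul α g⁻¹).quasiMeasurePreserving.ae h
        simpa [← mul_assoc] using h'
      · exact fun h => (measurePreserving_mk_mul α g).quasiMeasurePreserving.ae h
    simp only [this]
    simp
  have h2 : (∀ᵐ y ∂μ.prod α, p (q y)) ↔ ∀ᵐ g ∂μ, p (QuotientGroup.mk g) := by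
    rw [Measure.ae_prod_iff_ae_ae hE, Measure.ae_ae_comm hE]
    have : ∀ x, (∀ᵐ g ∂μ, p (q (g, x))) ↔ ∀ᵐ g ∂μ, p (QuotientGroup.mk g) := by
      intro x
      constructor
      · intro h
        have h' := (measurePreserving_mul_right μ (s x)⁻¹).quasiMeasurePreserving.ae h
        simpa [hq] using h'
      · exact fun h => (measurePreserving_mul_right μ (s x)).quasiMeasurePreserving.ae h
    simp only [this]
    simp
  exact h2.symm.trans h1

variable (α : Measure (G ⧸ Subgroup.center G)) (s : BorelSection G)
  (χ : Subgroup.center G →ₜ* Circle)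

/-- Measurable functions `f : G → ℂ` with `f (g h) = χ(h⁻¹) f(g)` for `h` in the centre, and with
`f ∘ s` in `L²(G/Z, α)`. -/
def covariantFun : Submodule ℂ (G → ℂ) where
  carrier := {f | Measurable f ∧
    (∀ (g : G) (h : Subgroup.center G), f (g * h) = (χ h⁻¹ : ℂ) * f g) ∧
    MemLp (fun x => f (s x)) 2 α}
  zero_mem' := ⟨measurable_const, by simp, MemLp.zero'⟩
  add_mem' := by
    rintro f₁ f₂ ⟨a, b, c⟩ ⟨a', b', c'⟩
    refine ⟨a.add a', fun g h => ?_, c.add c'⟩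
    simp [b, b', mul_add]
  smul_mem' := by
    rintro z f ⟨a, b, c⟩
    refine ⟨a.const_smul z, fun g h => ?_, c.const_smul z⟩
    simp only [Pi.smul_apply, smul_eq_mul, b]
    ring

/-- The functions in `covariantFun` that vanish `μ`-almost everywhere. -/
def nullFun (μ : Measure G) : Submodule ℂ (covariantFun α s χ) where
  carrier := {f | ∀ᵐ g ∂μ, (f : G → ℂ) g = 0}
  zero_mem' := by simp
  add_mem' := by
    intro f₁ f₂ h₁ h₂
    simp only [Set.mem_ofPred_eq] at h₁ h₂ ⊢
    filter_upwards [h₁, h₂] with g h₁ h₂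
    simp [h₁, h₂]
  smul_mem' := by
    intro z f h
    simp only [Set.mem_ofPred_eq] at h ⊢
    filter_upwards [h] with g h
    simp [h]

/-- The space `H^χ` of `μ`-equivalence classes of functions in `covariantFun`. -/
def IndSpace (μ : Measure G) : Type _ := covariantFun α s χ ⧸ nullFun α s χ μ

instance (μ : Measure G) : AddCommGroup (IndSpace α s χ μ) :=
  inferInstanceAs (AddCommGroup (covariantFun α s χ ⧸ nullFun α s χ μ))

instance (μ : Measure G) : Module ℂ (IndSpace α s χ μ) :=
  inferInstanceAs (Module ℂ (covariantFun α s χ ⧸ nullFun α s χ μ))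

/-- The class in `H^χ` of a function. -/
def toInd (μ : Measure G) : covariantFun α s χ →ₗ[ℂ] IndSpace α s χ μ :=
  (nullFun α s χ μ).mkQ

theorem toInd_surjective (μ : Measure G) : Function.Surjective (toInd α s χ μ) :=
  (nullFun α s χ μ).mkQ_surjective

/-- The map `f ↦ f ∘ s` from functions to `L²(G/Z, α)`. -/
def compSection : covariantFun α s χ →ₗ[ℂ] Lp ℂ 2 α where
  toFun f := f.2.2.2.toLp
  map_add' _ _ := rfl
  map_smul' _ _ := rfl

variable (μ : Measure G) [μ.IsHaarMeasure] [μ.IsMulRightInvariant] [α.IsHaarMeasure]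

theorem compSection_eq_zero_iff (f : covariantFun α s χ) :
    compSection α s χ f = 0 ↔ f ∈ nullFun α s χ μ := by
  have h1 : compSection α s χ f = 0 ↔ ∀ᵐ x ∂α, (f : G → ℂ) (s x) = 0 := by
    rw [Lp.eq_zero_iff_ae_eq_zero]
    have h := f.2.2.2.coeFn_toLp
    constructor
    · intro h'
      filter_upwards [h, h'] with x a b
      exact a.symm.trans b
    · intro h'
      filter_upwards [h, h'] with x a b
      exact a.trans b
  rw [h1, ← ae_mk_iff μ α s (p := fun x => (f : G → ℂ) (s x) = 0)
    ((f.2.1.comp s.measurable) (measurableSet_singleton 0))]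
  change _ ↔ ∀ᵐ g ∂μ, (f : G → ℂ) g = 0
  have : ∀ g : G, (f : G → ℂ) (s (QuotientGroup.mk g)) = 0 ↔ (f : G → ℂ) g = 0 := by
    intro g
    have hg : g⁻¹ * s (QuotientGroup.mk g) ∈ Subgroup.center G :=
      QuotientGroup.eq.1 (s.mk_apply (QuotientGroup.mk g)).symm
    have := f.2.2.1 g ⟨_, hg⟩
    simp only [mul_inv_cancel_left] at this
    rw [this]
    simp
  simp only [this]

/-- The map `J : H^χ → L²(G/Z, α)`, `J f = f ∘ s`. -/
def J : IndSpace α s χ μ →ₗ[ℂ] Lp ℂ 2 α :=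
  (nullFun α s χ μ).liftQ (compSection α s χ)
    fun f hf => (compSection_eq_zero_iff α s χ μ f).2 hf

theorem J_toInd (f : covariantFun α s χ) : J α s χ μ (toInd α s χ μ f) = compSection α s χ f :=
  rfl

theorem J_injective : Function.Injective (J α s χ μ) := by
  rw [injective_iff_map_eq_zero]
  intro f hf
  obtain ⟨f, rfl⟩ := toInd_surjective α s χ μ f
  exact (Submodule.Quotient.mk_eq_zero _).2 ((compSection_eq_zero_iff α s χ μ f).1 hf)

theorem J_surjective : Function.Surjective (J α s χ μ) := by
  intro φ
  have hmk : Measurable (QuotientGroup.mk : G → G ⧸ Subgroup.center G) :=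
    measurable_from_quotient.1 measurable_id
  have hmem : ∀ g : G, g⁻¹ * s (QuotientGroup.mk g) ∈ Subgroup.center G := fun g =>
    QuotientGroup.eq.1 (s.mk_apply (QuotientGroup.mk g)).symm
  have hφ : StronglyMeasurable φ := Lp.stronglyMeasurable φ
  have hs : ∀ x, s (QuotientGroup.mk (s x)) = s x := fun x => by rw [s.mk_apply]
  let f : G → ℂ := fun g => (χ ⟨_, hmem g⟩ : ℂ) * φ (QuotientGroup.mk g)
  have hfs : ∀ x, f (s x) = φ x := by
    intro x
    have : (⟨_, hmem (s x)⟩ : Subgroup.center G) = 1 := by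
      ext
      simp [hs]
    change (χ ⟨_, hmem (s x)⟩ : ℂ) * φ (QuotientGroup.mk (s x)) = _
    rw [this, map_one, Circle.coe_one, one_mul, s.mk_apply]
  have hf : f ∈ covariantFun α s χ := by
    refine ⟨?_, fun g h => ?_, ?_⟩
    · refine Measurable.mul ?_ (hφ.measurable.comp hmk)
      have h1 : Measurable fun h : Subgroup.center G => (χ h : ℂ) :=
        (continuous_subtype_val.comp χ.continuous_toFun).measurable
      have h2 : Measurable fun g : G => (⟨_, hmem g⟩ : Subgroup.center G) :=
        (measurable_inv.mul (s.measurable.comp hmk)).subtype_mk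
      exact h1.comp h2
    · have hgh : (QuotientGroup.mk (g * (h : G)) : G ⧸ Subgroup.center G) = QuotientGroup.mk g :=
        QuotientGroup.mk_mul_of_mem g h.2
      have : (⟨_, hmem (g * h)⟩ : Subgroup.center G) = h⁻¹ * ⟨_, hmem g⟩ := by
        ext
        simp [hgh, mul_assoc]
      change (χ ⟨_, hmem (g * h)⟩ : ℂ) * φ (QuotientGroup.mk (g * (h : G))) =
        (χ h⁻¹ : ℂ) * ((χ ⟨_, hmem g⟩ : ℂ) * φ (QuotientGroup.mk g))
      rw [this, hgh, map_mul, Circle.coe_mul, mul_assoc]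
    · simp only [hfs]
      exact Lp.memLp φ
  refine ⟨toInd α s χ μ ⟨f, hf⟩, ?_⟩
  rw [J_toInd]
  refine Lp.ext ?_
  refine hf.2.2.coeFn_toLp.trans ?_
  exact Eventually.of_forall hfs

instance : NormedAddCommGroup (IndSpace α s χ μ) :=
  NormedAddCommGroup.induced _ _ (J α s χ μ) (J_injective α s χ μ)

/-- The scalar product `⟨f₁, f₂⟩ = ∫ conj (f₁(s x)) f₂(s x) dα(x)` of `H^χ`,
see `inner_toInd`. -/
instance : InnerProductSpace ℂ (IndSpace α s χ μ) where
  norm_smul_le z f := by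
    change ‖J α s χ μ (z • f)‖ ≤ ‖z‖ * ‖J α s χ μ f‖
    rw [map_smul, norm_smul]
  inner f₁ f₂ := inner ℂ (J α s χ μ f₁) (J α s χ μ f₂)
  norm_sq_eq_re_inner f := norm_sq_eq_re_inner (𝕜 := ℂ) (J α s χ μ f)
  conj_inner_symm f₁ f₂ := inner_conj_symm _ _
  add_left f₁ f₂ f₃ := by rw [map_add, inner_add_left]
  smul_left f₁ f₂ z := by rw [map_smul, inner_smul_left]

theorem inner_toInd (f₁ f₂ : covariantFun α s χ) :
    inner ℂ (toInd α s χ μ f₁) (toInd α s χ μ f₂) =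
      ∫ x, conj ((f₁ : G → ℂ) (s x)) * (f₂ : G → ℂ) (s x) ∂α := by
  change inner ℂ (compSection α s χ f₁) (compSection α s χ f₂) = _
  rw [L2.inner_def]
  refine integral_congr_ae ?_
  filter_upwards [f₁.2.2.2.coeFn_toLp, f₂.2.2.2.coeFn_toLp] with x h₁ h₂
  change inner ℂ (f₁.2.2.2.toLp _ x) (f₂.2.2.2.toLp _ x) = _
  rw [h₁, h₂, RCLike.inner_apply, mul_comm]

theorem norm_toInd (f : covariantFun α s χ) :
    ‖toInd α s χ μ f‖ = (eLpNorm (fun x => (f : G → ℂ) (s x)) 2 α).toReal :=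
  Lp.norm_toLp _ f.2.2.2

/-- `J` is a unitary operator. -/
def JIso : IndSpace α s χ μ ≃ₗᵢ[ℂ] Lp ℂ 2 α where
  toLinearEquiv := LinearEquiv.ofBijective (J α s χ μ) ⟨J_injective α s χ μ, J_surjective α s χ μ⟩
  norm_map' _ := rfl

instance : CompleteSpace (IndSpace α s χ μ) :=
  (JIso α s χ μ).toIsometryEquiv.completeSpace

theorem norm_comp_eq {f : G → ℂ}
    (hf : ∀ (g : G) (h : Subgroup.center G), f (g * h) = (χ h⁻¹ : ℂ) * f g) (a : G)
    (x : G ⧸ Subgroup.center G) :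
    ‖f (a * s x)‖ = ‖f (s ((QuotientGroup.mk a : G ⧸ Subgroup.center G) * x))‖ := by
  have hmem : (a * s x)⁻¹ * s ((QuotientGroup.mk a : G ⧸ Subgroup.center G) * x) ∈
      Subgroup.center G := by
    refine QuotientGroup.eq.1 ?_
    rw [s.mk_apply, QuotientGroup.mk_mul, s.mk_apply]
  have := hf (a * s x) ⟨_, hmem⟩
  simp only [mul_inv_cancel_left] at this
  rw [this, norm_mul, Circle.norm_coe, one_mul]

theorem eLpNorm_translate (f : covariantFun α s χ) (a : G) :
    eLpNorm (fun x => (f : G → ℂ) (a * s x)) 2 α = eLpNorm (fun x => (f : G → ℂ) (s x)) 2 α := by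
  rw [eLpNorm_congr_norm_ae (Eventually.of_forall (norm_comp_eq s χ f.2.2.1 a))]
  exact eLpNorm_comp_measurePreserving f.2.2.2.1 (measurePreserving_mk_mul α a)

/-- Left translation `(l(a) f)(g) = f(a⁻¹ g)` on functions. -/
def leftTranslate (a : G) : covariantFun α s χ →ₗ[ℂ] covariantFun α s χ where
  toFun f := ⟨fun g => (f : G → ℂ) (a⁻¹ * g), by
    have hm : Measurable fun g => (f : G → ℂ) (a⁻¹ * g) := f.2.1.comp (measurable_const_mul a⁻¹)
    refine ⟨hm, fun g h => ?_, ?_, ?_⟩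
    · change (f : G → ℂ) (a⁻¹ * (g * h)) = _
      rw [← mul_assoc, f.2.2.1]
    · exact (hm.comp s.measurable).aestronglyMeasurable
    · rw [eLpNorm_translate]
      exact f.2.2.2.2⟩
  map_add' _ _ := rfl
  map_smul' _ _ := rfl

/-- Left translation on classes. -/
def leftTranslateInd (a : G) : IndSpace α s χ μ →ₗ[ℂ] IndSpace α s χ μ :=
  (nullFun α s χ μ).mapQ (nullFun α s χ μ) (leftTranslate α s χ a) (by
    intro f hf
    exact (quasiMeasurePreserving_mul_left μ a⁻¹).ae hf)

theorem leftTranslateInd_toInd (a : G) (f : covariantFun α s χ) :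
    leftTranslateInd α s χ μ a (toInd α s χ μ f) = toInd α s χ μ (leftTranslate α s χ a f) := rfl

/-- The induced representation `(l(a) f)(g) = f(a⁻¹ g)` of `G` on `H^χ`. -/
def inducedRep : G →* (IndSpace α s χ μ ≃ₗᵢ[ℂ] IndSpace α s χ μ) where
  toFun a :=
    { toFun := leftTranslateInd α s χ μ a
      invFun := leftTranslateInd α s χ μ a⁻¹
      map_add' := map_add _
      map_smul' := map_smul _
      left_inv := fun f => by
        obtain ⟨f, rfl⟩ := toInd_surjective α s χ μ f
        rw [leftTranslateInd_toInd, leftTranslateInd_toInd]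
        congr 1
        ext g
        simp [leftTranslate]
      right_inv := fun f => by
        obtain ⟨f, rfl⟩ := toInd_surjective α s χ μ f
        rw [leftTranslateInd_toInd, leftTranslateInd_toInd]
        congr 1
        ext g
        simp [leftTranslate]
      norm_map' := fun f => by
        obtain ⟨f, rfl⟩ := toInd_surjective α s χ μ f
        change ‖leftTranslateInd α s χ μ a (toInd α s χ μ f)‖ = _
        rw [leftTranslateInd_toInd, norm_toInd, norm_toInd]
        congr 1
        exact eLpNorm_translate α s χ f a⁻¹ }
  map_one' := by
    ext f
    obtain ⟨f, rfl⟩ := toInd_surjective α s χ μ f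
    change leftTranslateInd α s χ μ 1 (toInd α s χ μ f) = toInd α s χ μ f
    rw [leftTranslateInd_toInd]
    congr 1
    ext g
    simp [leftTranslate]
  map_mul' a b := by
    ext f
    obtain ⟨f, rfl⟩ := toInd_surjective α s χ μ f
    change leftTranslateInd α s χ μ (a * b) (toInd α s χ μ f) =
      leftTranslateInd α s χ μ a (leftTranslateInd α s χ μ b (toInd α s χ μ f))
    rw [leftTranslateInd_toInd, leftTranslateInd_toInd, leftTranslateInd_toInd]
    congr 1
    ext g
    simp [leftTranslate, mul_assoc]

theorem inducedRep_toInd (a : G) (f : covariantFun α s χ) :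
    inducedRep α s χ μ a (toInd α s χ μ f) = toInd α s χ μ (leftTranslate α s χ a f) := rfl

/-! ### The operators `W_u` -/

variable {H : Type*} [NormedAddCommGroup H] [InnerProductSpace ℂ H]
  {π : G →* (H ≃ₗᵢ[ℂ] H)}

variable {α s χ} in
theorem coeff_mem (hcont : IsContinuousRep π) (hχ : IsCentralCharacter π χ)
    (hsq : IsSquareIntegrableModCenter α s π) (u v : H) :
    coeff π u v ∈ covariantFun α s χ := by
  refine ⟨((hcont u).inner continuous_const).measurable, fun g h => ?_, hsq u v⟩
  have : π (g * h) u = (χ h : ℂ) • π g u := by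
    rw [map_mul]
    change π g (π h u) = _
    rw [hχ, map_smul]
  change inner ℂ (π (g * h) u) v = (χ h⁻¹ : ℂ) * inner ℂ (π g u) v
  rw [this, inner_smul_left, map_inv, Circle.coe_inv_eq_conj]

variable {α s χ} in
/-- The linear map `v ↦ c_{u,v}` from `H` to `H^χ`. -/
def WLin (hcont : IsContinuousRep π) (hχ : IsCentralCharacter π χ)
    (hsq : IsSquareIntegrableModCenter α s π) (u : H) : H →ₗ[ℂ] IndSpace α s χ μ :=
  toInd α s χ μ ∘ₗ
    { toFun := fun v => ⟨coeff π u v, coeff_mem hcont hχ hsq u v⟩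
      map_add' := fun v w => by
        ext g; simp [coeff]
      map_smul' := fun z v => by
        ext g; simp [coeff] }

variable {α s χ} in
theorem WLin_continuous [CompleteSpace H] (hcont : IsContinuousRep π)
    (hχ : IsCentralCharacter π χ) (hsq : IsSquareIntegrableModCenter α s π) (u : H) :
    Continuous (WLin μ hcont hχ hsq u) := by
  refine LinearMap.continuous_of_seq_closed_graph _ fun v w y hv hy => ?_
  -- the sequence converges to `y` in `L²`, and pointwise to `c_{u,w}`
  refine J_injective α s χ μ ?_
  have hJ : Tendsto (fun n => J α s χ μ (WLin μ hcont hχ hsq u (v n))) atTop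
      (𝓝 (J α s χ μ y)) := ((JIso α s χ μ).continuous.tendsto y).comp hy
  obtain ⟨ns, hns, hlim⟩ := (tendstoInMeasure_of_tendsto_Lp hJ).exists_seq_tendsto_ae
  have hcoe : ∀ v, (J α s χ μ (WLin μ hcont hχ hsq u v) : G ⧸ Subgroup.center G → ℂ) =ᵐ[α]
      fun x => coeff π u v (s x) := fun v => (hsq u v).coeFn_toLp
  refine Lp.ext ?_
  filter_upwards [hlim, hcoe w, ae_all_iff.2 fun n => hcoe (v n)] with x h1 h2 h3
  rw [h2]
  refine tendsto_nhds_unique h1 ?_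
  simp only [h3]
  exact (tendsto_const_nhds.inner hv).comp hns.tendsto_atTop

variable {α s χ} in
/-- The bounded operator `W_u : H → H^χ`, `W_u v = c_{u,v}`. -/
def W [CompleteSpace H] (hcont : IsContinuousRep π)
    (hχ : IsCentralCharacter π χ) (hsq : IsSquareIntegrableModCenter α s π) (u : H) :
    H →L[ℂ] IndSpace α s χ μ :=
  ⟨WLin μ hcont hχ hsq u, WLin_continuous μ hcont hχ hsq u⟩

end Induced

end PhaseSpace

end

/-!
The operators `W_u` intertwine `π` with the induced representation `l`. By Schur's lemma
`W_u* W_{u'}` is a scalar. As `G` is unimodular and `Z` is central, Haar measure on `G/Z` is right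
invariant and inversion invariant (`isMulRightInvariant_quotient`, `isInvInvariant_quotient`), so
that `c_{u,v}(g⁻¹) = conj c_{v,u}(g)` turns Schur's lemma into the orthogonality relations
`⟨W_u v, W_{u'} v'⟩ = ⟨u', u⟩ ⟨v, v'⟩` (`inner_W_W`). Hence the `W_{e_i}` are isometries with
mutually orthogonal ranges, each `W_{e_i} W_{e_i}*` is a projection, and these projections resolve
the identity iff the coefficients of `π` span a dense subspace of `H^χ`
(`isResolutionOfIdentity_iff_total`). In that case `l` is the Hilbert sum of the copies
`W_{e_i}` of `π`.

Conversely, every bounded intertwiner `T` from `π` to `l` takes its values in the closed span of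
the coefficients (`inner_intertwiner_eq_zero`). If `T v` is represented by the function `f`, then
`c_{T* φ, v}(g) = ⟨l(g) φ, f⟩`. For `h` orthogonal to all coefficients, Fubini's theorem rewrites
`0 = ⟨h, c_{T* φ, v}⟩` as `⟨φ, Ψ⟩ = 0` with `Ψ(z) = ⟨h, r(z) f⟩`, `r` being right translation; as
`φ` is arbitrary, `Ψ` vanishes almost everywhere. Since `H^χ` is separable, a single `z` serves
for all `h`, and since the span of the coefficients is stable under `r`, the vector `T v` itself
lies in its closure. If now `l` is a Hilbert sum of copies `T_j` of an irreducible `σ`, some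
`T_i* W_u` is non-zero and has dense range, so the range of each `T_j` is contained in the closure
of the range of the intertwiner `T_j T_i* W_u`, and the coefficients span a dense subspace.
-/

namespace PhaseSpace

/-! ### Haar measure on the quotient by the centre -/

section Measure

variable {G : Type*} [Group G] [TopologicalSpace G] [IsTopologicalGroup G]
  [LocallyCompactSpace G] [SecondCountableTopology G] [MeasurableSpace G] [BorelSpace G]

theorem measurable_quotient_mk :
    Measurable (QuotientGroup.mk : G → G ⧸ Subgroup.center G) :=
  measurable_from_quotient.1 measurable_id

/-- A function on `G` that is invariant under the centre factors through the section. -/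
theorem BorelSection.apply_mk {E : Type*} (s : BorelSection G) {F : G → E}
    (hF : ∀ (g : G) (h : Subgroup.center G), F (g * h) = F g) (g : G) :
    F (s (QuotientGroup.mk g)) = F g := by
  have hg : g⁻¹ * s (QuotientGroup.mk g) ∈ Subgroup.center G :=
    QuotientGroup.eq.1 (s.mk_apply (QuotientGroup.mk g)).symm
  simpa using hF g ⟨_, hg⟩

/-- Multiplication on `G/Z` is measurable since `x y` is the class of `s(x) s(y)`. -/
theorem BorelSection.measurableMul₂ (s : BorelSection G) :
    MeasurableMul₂ (G ⧸ Subgroup.center G) where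
  measurable_mul := by
    have h : Measurable fun y : (G ⧸ Subgroup.center G) × (G ⧸ Subgroup.center G) =>
        (QuotientGroup.mk (s y.1 * s y.2) : G ⧸ Subgroup.center G) :=
      measurable_quotient_mk.comp
        ((s.measurable.comp measurable_fst).mul (s.measurable.comp measurable_snd))
    simpa only [QuotientGroup.mk_mul, s.mk_apply] using h

theorem BorelSection.measurableInv (s : BorelSection G) :
    MeasurableInv (G ⧸ Subgroup.center G) where
  measurable_inv := by
    have h : Measurable fun x : G ⧸ Subgroup.center G =>
        (QuotientGroup.mk (s x)⁻¹ : G ⧸ Subgroup.center G) :=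
      measurable_quotient_mk.comp s.measurable.inv
    simpa only [QuotientGroup.mk_inv, s.mk_apply] using h

/-- The quotient σ-algebra is pulled back along the section, hence countably generated. -/
theorem BorelSection.countablyGenerated (s : BorelSection G) :
    MeasurableSpace.CountablyGenerated (G ⧸ Subgroup.center G) := by
  have : (inferInstance : MeasurableSpace (G ⧸ Subgroup.center G)) =
      MeasurableSpace.comap s inferInstance := by
    refine le_antisymm (fun A hA => ?_) s.measurable.comap_le
    refine ⟨QuotientGroup.mk ⁻¹' A, measurable_quotient_mk hA, ?_⟩
    ext x
    simp [s.mk_apply]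
  have h := MeasurableSpace.CountablyGenerated.comap (m := (inferInstance : MeasurableSpace G)) s
  rwa [← this] at h

/-- The Borel isomorphism `(x, h) ↦ s(x) h` between `G/Z × Z` and `G`. -/
def BorelSection.prodEquiv (s : BorelSection G) :
    (G ⧸ Subgroup.center G) × Subgroup.center G ≃ᵐ G where
  toFun y := s y.1 * y.2
  invFun g := (QuotientGroup.mk g, ⟨(s (QuotientGroup.mk g))⁻¹ * g,
    QuotientGroup.eq.1 (s.mk_apply (QuotientGroup.mk g))⟩)
  left_inv := by
    rintro ⟨x, h⟩
    have : (QuotientGroup.mk (s x * (h : G)) : G ⧸ Subgroup.center G) = x := by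
      rw [QuotientGroup.mk_mul_of_mem _ h.2, s.mk_apply]
    ext <;> simp [this]
  right_inv g := by simp
  measurable_toFun := (s.measurable.comp measurable_fst).mul
    (measurable_subtype_coe.comp measurable_snd)
  measurable_invFun := measurable_quotient_mk.prodMk
    (((s.measurable.comp measurable_quotient_mk).inv.mul measurable_id).subtype_mk)

/-- A Haar measure on `G/Z` is right invariant when `G` is unimodular. The product of a left
invariant measure `α` on `G/Z` with a Haar measure of the centre is carried to a left invariant
measure on `G`, hence to a multiple of `μ`; the right translations of `G` act on it through the
first factor only, because the centre is central. -/
theorem isMulRightInvariant_quotient [T2Space G] (μ : Measure G) [μ.IsHaarMeasure]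
    [μ.IsMulRightInvariant] (α : Measure (G ⧸ Subgroup.center G)) [α.IsHaarMeasure]
    (s : BorelSection G) : α.IsMulRightInvariant := by
  have := s.measurableMul₂
  have : LocallyCompactSpace (Subgroup.center G) := by
    have : IsClosed (Subgroup.center G : Set G) := by
      have : (Subgroup.center G : Set G) = ⋂ g : G, {z | g * z = z * g} := by
        ext z
        simp [Subgroup.mem_center_iff]
      rw [this]
      exact isClosed_iInter fun g =>
        isClosed_eq (continuous_const_mul g) (continuous_mul_const g)
    exact this.isClosedEmbedding_subtypeVal.locallyCompactSpace
  have : SecondCountableTopology (Subgroup.center G) :=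
    TopologicalSpace.Subtype.secondCountableTopology _
  obtain ⟨K₀⟩ : Nonempty (TopologicalSpace.PositiveCompacts (Subgroup.center G)) := inferInstance
  set η : Measure (Subgroup.center G) := Measure.haarMeasure K₀ with hη
  set e := s.prodEquiv with he
  set ν : Measure G := (α.prod η).map e with hν
  have hmul : ∀ (g : G) (h : Subgroup.center G), g * (h : G) = h * g := fun g h =>
    Subgroup.mem_center_iff.1 h.2 g
  -- left translation of `G` read in `G/Z × Z`
  have hleft : ∀ a : G, ν.map (a * ·) = ν := by
    intro a
    let k : G ⧸ Subgroup.center G → Subgroup.center G := fun x =>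
      ⟨(s ((a : G ⧸ Subgroup.center G) * x))⁻¹ * (a * s x), by
        refine QuotientGroup.eq.1 ?_
        rw [s.mk_apply, QuotientGroup.mk_mul, s.mk_apply]⟩
    have hk : Measurable k := by
      refine Measurable.subtype_mk ?_
      exact (s.measurable.comp (measurable_const_mul _)).inv.mul
        (s.measurable.const_mul a)
    have h1 : MeasurePreserving (fun y : (G ⧸ Subgroup.center G) × Subgroup.center G =>
        ((a : G ⧸ Subgroup.center G) * y.1, k y.1 * y.2)) (α.prod η) (α.prod η) :=
      (measurePreserving_mk_mul α a).skew_product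
        ((hk.comp measurable_fst).mul measurable_snd)
        (Eventually.of_forall fun x => map_mul_left_eq_self η (k x))
    rw [hν, Measure.map_map (measurable_const_mul a) e.measurable]
    conv_rhs => rw [← h1.map_eq]
    rw [Measure.map_map e.measurable h1.measurable]
    congr 1
    ext y
    simp [he, BorelSection.prodEquiv, k, mul_assoc]
  have hνinv : ν.IsMulLeftInvariant := ⟨hleft⟩
  have hνσ : SigmaFinite ν := e.sigmaFinite_map
  obtain ⟨K⟩ : Nonempty (TopologicalSpace.PositiveCompacts G) := inferInstance
  have hνμ := measure_eq_div_smul ν μ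
    (Measure.measure_pos_of_nonempty_interior μ K.interior_nonempty).ne'
    (K.isCompact.measure_ne_top (μ := μ))
  -- the factor `ν K / μ K` need not be known: any multiple of `μ` is right invariant
  have hright : ∀ a : G, ν.map (· * a) = ν := by
    intro a
    rw [hνμ, Measure.map_smul, map_mul_right_eq_self μ a]
  refine ⟨fun b => ?_⟩
  obtain ⟨a, rfl⟩ := QuotientGroup.mk_surjective b
  -- right translation by `a` is `(x, h) ↦ (x a, k(x) h)`, as `h` is central
  let k : G ⧸ Subgroup.center G → Subgroup.center G := fun x =>
    ⟨(s (x * (a : G ⧸ Subgroup.center G)))⁻¹ * (s x * a), by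
      refine QuotientGroup.eq.1 ?_
      rw [s.mk_apply, QuotientGroup.mk_mul, s.mk_apply]⟩
  have hk : Measurable k := by
    refine Measurable.subtype_mk ?_
    exact (s.measurable.comp (measurable_mul_const _)).inv.mul
      (s.measurable.mul_const a)
  set α' : Measure (G ⧸ Subgroup.center G) := α.map (· * (a : G ⧸ Subgroup.center G)) with hα'
  have h1 : MeasurePreserving (fun y : (G ⧸ Subgroup.center G) × Subgroup.center G =>
      (y.1 * (a : G ⧸ Subgroup.center G), k y.1 * y.2)) (α.prod η) (α'.prod η) :=
    MeasurePreserving.skew_product ⟨measurable_mul_const _, rfl⟩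
      ((hk.comp measurable_fst).mul measurable_snd)
      (Eventually.of_forall fun x => map_mul_left_eq_self η (k x))
  have h2 : (α'.prod η).map e = (α.prod η).map e := by
    change _ = ν
    conv_rhs => rw [← hright a]
    rw [hν, Measure.map_map (measurable_mul_const a) e.measurable, ← h1.map_eq,
      Measure.map_map e.measurable h1.measurable]
    congr 1
    ext y
    simp [he, BorelSection.prodEquiv, k, mul_assoc, hmul a]
  have h3 : α'.prod η = α.prod η := by
    have := congrArg (Measure.map e.symm) h2
    rwa [e.map_symm_map, e.map_symm_map] at this
  ext A hA
  have h4 := congrArg (fun m => m (A ×ˢ (K₀ : Set (Subgroup.center G)))) h3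
  simp only [Measure.prod_prod] at h4
  refine (ENNReal.mul_left_inj ?_ ?_).1 h4
  · simp [hη, Measure.haarMeasure_self]
  · simp [hη, Measure.haarMeasure_self]

/-- A left and right invariant Haar measure on `G/Z` is inversion invariant: it agrees with its
image under inversion on a symmetric compact neighbourhood of the identity. -/
theorem isInvInvariant_quotient (α : Measure (G ⧸ Subgroup.center G)) [α.IsHaarMeasure]
    [α.IsMulRightInvariant] (s : BorelSection G) : α.IsInvInvariant := by
  have := s.measurableMul₂
  have := s.measurableInv
  obtain ⟨K⟩ : Nonempty (TopologicalSpace.PositiveCompacts (G ⧸ Subgroup.center G)) :=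
    inferInstance
  set S : Set (G ⧸ Subgroup.center G) := K ∪ (K : Set (G ⧸ Subgroup.center G))⁻¹ with hS
  have hSc : IsCompact S := K.isCompact.union K.isCompact.inv
  have hS0 : α S ≠ 0 := ((Measure.measure_pos_of_nonempty_interior α K.interior_nonempty).trans_le
    (measure_mono Set.subset_union_left)).ne'
  have hSi : S⁻¹ = S := by simp [hS, Set.union_comm]
  refine ⟨?_⟩
  rw [measure_eq_div_smul α.inv α hS0 hSc.measure_ne_top, Measure.inv_apply, hSi,
    ENNReal.div_self hS0 hSc.measure_ne_top, one_smul]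

end Measure

/-! ### Schur's lemma -/

section Schur

variable {G : Type*} [Group G] {H : Type*} [NormedAddCommGroup H] [InnerProductSpace ℂ H]
  {π : G →* (H ≃ₗᵢ[ℂ] H)}

theorem inner_rep_left (π : G →* (H ≃ₗᵢ[ℂ] H)) (g : G) (x y : H) :
    inner ℂ (π g x) y = inner ℂ x (π g⁻¹ y) := by
  rw [← (π g⁻¹).inner_map_map (π g x) y]
  congr 1
  change (π g⁻¹ * π g) x = x
  rw [← map_mul]
  simp

theorem adjoint_intertwines [CompleteSpace H] {K : Type*} [NormedAddCommGroup K]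
    [InnerProductSpace ℂ K] [CompleteSpace K] {σ : G →* (K ≃ₗᵢ[ℂ] K)} {A : H →L[ℂ] K}
    (hA : ∀ g v, A (π g v) = σ g (A v)) (g : G) (w : K) :
    A.adjoint (σ g w) = π g (A.adjoint w) := by
  refine ext_inner_right ℂ fun v => ?_
  rw [ContinuousLinearMap.adjoint_inner_left, inner_rep_left, inner_rep_left,
    ContinuousLinearMap.adjoint_inner_left, hA]

/-- A non-zero operator intertwining a representation with an irreducible one has dense range. -/
theorem IsIrreducibleRep.closure_range_eq_top {K : Type*} [NormedAddCommGroup K]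
    [InnerProductSpace ℂ K] {σ : G →* (K ≃ₗᵢ[ℂ] K)} (hirr : IsIrreducibleRep σ) {A : H →L[ℂ] K}
    (hA : ∀ g v, A (π g v) = σ g (A v)) {v : H} (hv : A v ≠ 0) :
    (LinearMap.range (A : H →ₗ[ℂ] K)).topologicalClosure = ⊤ := by
  set V := LinearMap.range (A : H →ₗ[ℂ] K) with hV
  have hmem : A v ∈ V.topologicalClosure := V.le_topologicalClosure ⟨v, rfl⟩
  refine (hirr.2 V.topologicalClosure V.isClosed_topologicalClosure ?_).resolve_left ?_
  · intro g w hw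
    refine map_mem_closure (σ g).continuous hw ?_
    rintro _ ⟨x, rfl⟩
    exact ⟨π g x, hA g x⟩
  · intro h
    rw [h] at hmem
    exact hv ((Submodule.mem_bot ℂ).1 hmem)

/-- Of two operators with product zero commuting with an irreducible representation, one is
zero: the kernel of the first is a closed invariant subspace. -/
theorem IsIrreducibleRep.eq_zero_or_eq_zero (hirr : IsIrreducibleRep π) {A B : H →L[ℂ] H}
    (hA : ∀ g v, A (π g v) = π g (A v)) (hAB : A * B = 0) : A = 0 ∨ B = 0 := by
  rcases hirr.2 (LinearMap.ker (A : H →ₗ[ℂ] H)) A.isClosed_ker (fun g v hv => by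
    have hv' : A v = 0 := hv
    change A (π g v) = 0
    rw [hA, hv', map_zero]) with h | h
  · right
    ext v
    have : B v ∈ LinearMap.ker (A : H →ₗ[ℂ] H) := congrArg (fun C : H →L[ℂ] H => C v) hAB
    rw [h] at this
    simpa using this
  · left
    ext v
    have : v ∈ LinearMap.ker (A : H →ₗ[ℂ] H) := h ▸ Submodule.mem_top
    simpa using this

variable [CompleteSpace H]

/-- Schur's lemma for self-adjoint operators. If the spectrum had two points, bump functions at
these points would give, through the continuous functional calculus, two non-zero operators with
product zero in the commutant. -/
theorem IsIrreducibleRep.exists_eq_smul_of_isSelfAdjoint (hirr : IsIrreducibleRep π)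
    {A : H →L[ℂ] H} (hA : ∀ g v, A (π g v) = π g (A v)) (hsa : IsSelfAdjoint A) :
    ∃ c : ℂ, ∀ v, A v = c • v := by
  have := hirr.1
  obtain ⟨r, hr⟩ := ContinuousFunctionalCalculus.spectrum_nonempty (R := ℝ) A hsa
  have hcomm : ∀ (f : ℝ → ℝ) (g : G) (v : H), (cfc f A) (π g v) = π g ((cfc f A) v) := by
    intro f g v
    have h : Commute A (π g : H →L[ℂ] H) := by
      ext v
      exact hA g v
    exact congrArg (fun C : H →L[ℂ] H => C v) (h.cfc_real f).eq
  have hsub : spectrum ℝ A ⊆ {r} := by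
    intro t ht
    by_contra hne
    have hne : t ≠ r := hne
    have hd : 0 < |t - r| / 2 := half_pos (abs_pos.2 (sub_ne_zero.2 hne))
    let bump : ℝ → ℝ → ℝ := fun a x => max 0 (|t - r| / 2 - |x - a|)
    have hbc : ∀ a, Continuous (bump a) := fun a => by fun_prop
    have hprod : cfc (bump t) A * cfc (bump r) A = 0 := by
      rw [← cfc_mul (bump t) (bump r) A (hbc t).continuousOn (hbc r).continuousOn]
      have : (fun x => bump t x * bump r x) = fun _ => 0 := by
        ext x
        have h := abs_sub_le t x r
        rw [abs_sub_comm t x] at h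
        rcases le_or_gt (|t - r| / 2) |x - t| with h1 | h1
        · simp [bump, max_eq_left (sub_nonpos.2 h1)]
        · have h2 : |t - r| / 2 ≤ |x - r| := by linarith
          simp [bump, max_eq_left (sub_nonpos.2 h2)]
      rw [this, cfc_const_zero]
    have hne0 : ∀ a ∈ spectrum ℝ A, cfc (bump a) A ≠ 0 := by
      intro a ha h0
      rw [← cfc_const_zero ℝ A] at h0
      have := eqOn_of_cfc_eq_cfc h0 (hbc a).continuousOn continuousOn_const hsa ha
      simp only [bump, sub_self, abs_zero, sub_zero, max_eq_right hd.le] at this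
      exact hd.ne' this
    rcases hirr.eq_zero_or_eq_zero (hcomm _) hprod with h | h
    · exact hne0 t ht h
    · exact hne0 r hr h
  have hAr := CFC.eq_algebraMap_of_spectrum_subset_singleton A r hsub hsa
  refine ⟨r, fun v => ?_⟩
  conv_lhs => rw [hAr]
  simp [Algebra.algebraMap_eq_smul_one]

/-- Schur's lemma: a bounded operator commuting with an irreducible unitary representation is a
scalar. -/
theorem IsIrreducibleRep.exists_eq_smul (hirr : IsIrreducibleRep π)
    {A : H →L[ℂ] H} (hA : ∀ g v, A (π g v) = π g (A v)) : ∃ c : ℂ, ∀ v, A v = c • v := by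
  have hA' := adjoint_intertwines hA
  obtain ⟨a, ha⟩ := hirr.exists_eq_smul_of_isSelfAdjoint (A := A + A.adjoint)
    (fun g v => by simp [hA, hA']) (IsSelfAdjoint.add_star_self A)
  obtain ⟨b, hb⟩ := hirr.exists_eq_smul_of_isSelfAdjoint (A := Complex.I • (A - A.adjoint))
    (fun g v => by simp [hA, hA']) (by
      rw [IsSelfAdjoint, ContinuousLinearMap.star_eq_adjoint, map_smulₛₗ, map_sub,
        ContinuousLinearMap.adjoint_adjoint, Complex.conj_I, neg_smul, ← smul_neg, neg_sub])
  refine ⟨(a - Complex.I * b) / 2, fun v => ?_⟩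
  have h1 := ha v
  have h2 := congrArg (fun w => Complex.I • w) (hb v)
  simp only [_root_.smul_apply, _root_.sub_apply, smul_smul,
    Complex.I_mul_I, _root_.add_apply] at h1 h2
  have h3 : (2 : ℂ) • A v = (a - Complex.I * b) • v := by
    rw [sub_smul, ← h1, ← h2]
    module
  rw [div_eq_inv_mul, mul_smul, ← h3, smul_smul]
  norm_num

end Schur

/-! ### Hilbert sums and resolutions of the identity -/

section HilbertSum

variable {ι H K : Type*} [NormedAddCommGroup H] [InnerProductSpace ℂ H] [CompleteSpace H]
  [NormedAddCommGroup K] [InnerProductSpace ℂ K] [CompleteSpace K]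

theorem isStarProjection_comp_adjoint {V : H →L[ℂ] K}
    (hV : ∀ x y, inner ℂ (V x) (V y) = inner ℂ x y) : IsStarProjection (V ∘L V.adjoint) := by
  have h1 : ∀ x, V.adjoint (V x) = x := fun x =>
    ext_inner_right ℂ fun y => by rw [ContinuousLinearMap.adjoint_inner_left, hV]
  refine ⟨?_, ?_⟩
  · ext w
    simp [h1]
  · rw [IsSelfAdjoint, ContinuousLinearMap.star_eq_adjoint, ContinuousLinearMap.adjoint_comp,
      ContinuousLinearMap.adjoint_adjoint]

/-- An orthogonal family of isometries with no common orthogonal vector is a Hilbert sum. -/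
theorem isHilbertSum_of_total {V : ι → H →ₗᵢ[ℂ] K}
    (horth : ∀ i j, i ≠ j → ∀ x y, inner ℂ (V i x) (V j y) = 0)
    (htot : ∀ f, (∀ i x, inner ℂ (V i x) f = 0) → f = 0) :
    IsHilbertSum ℂ (fun _ : ι => H) V := by
  refine IsHilbertSum.mk (fun i j hij x y => horth i j hij x y) ?_
  rw [top_le_iff, Submodule.topologicalClosure_eq_top_iff, Submodule.eq_bot_iff]
  intro f hf
  exact htot f fun i x => (Submodule.mem_orthogonal _ _).1 hf _
    (Submodule.mem_iSup_of_mem i ⟨x, rfl⟩)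

theorem total_of_isHilbertSum {V : ι → H →ₗᵢ[ℂ] K} (h : IsHilbertSum ℂ (fun _ : ι => H) V)
    {f : K} (hf : ∀ i x, inner ℂ (V i x) f = 0) : f = 0 := by
  have h1 := h.hasSum_linearIsometryEquiv_symm (h.linearIsometryEquiv f)
  rw [LinearIsometryEquiv.symm_apply_apply] at h1
  have h2 := h1.mapL (innerSL ℂ f)
  have h3 : inner ℂ f f = 0 := by
    refine h2.unique ?_
    have : ∀ i x, inner ℂ f (V i x) = 0 := fun i x => inner_eq_zero_symm.1 (hf i x)
    simp [this, hasSum_zero]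
  exact inner_self_eq_zero.1 h3

/-- For isometries with mutually orthogonal ranges, the range projections resolve the identity
iff no non-zero vector is orthogonal to all the ranges. -/
theorem isResolutionOfIdentity_iff_total {V : ι → H →L[ℂ] K}
    (hV : ∀ i x y, inner ℂ (V i x) (V i y) = inner ℂ x y)
    (horth : ∀ i j, i ≠ j → ∀ x y, inner ℂ (V i x) (V j y) = 0) :
    IsResolutionOfIdentity (fun i => V i ∘L (V i).adjoint) ↔
      ∀ f, (∀ i x, inner ℂ (V i x) f = 0) → f = 0 := by
  have hadj : ∀ i j, i ≠ j → ∀ x, (V i).adjoint (V j x) = 0 := fun i j hij x =>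
    ext_inner_left ℂ fun y => by
      rw [ContinuousLinearMap.adjoint_inner_right, horth i j hij, inner_zero_right]
  have hadj' : ∀ i x, (V i).adjoint (V i x) = x := fun i x =>
    ext_inner_left ℂ fun y => by rw [ContinuousLinearMap.adjoint_inner_right, hV]
  constructor
  · rintro ⟨-, -, h⟩ f hf
    refine (h f).unique ?_
    have : ∀ i, (V i).adjoint f = 0 := fun i => ext_inner_left ℂ fun y => by
      rw [ContinuousLinearMap.adjoint_inner_right, hf, inner_zero_right]
    simp [this, hasSum_zero]
  · intro htot
    refine ⟨fun i => isStarProjection_comp_adjoint (hV i), fun i j hij => ?_, fun f => ?_⟩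
    · ext f
      simp [hadj i j hij]
    · let U : ι → H →ₗᵢ[ℂ] K := fun i => LinearMap.isometryOfInner (V i : H →ₗ[ℂ] K) (hV i)
      have hU : IsHilbertSum ℂ (fun _ : ι => H) U := isHilbertSum_of_total horth htot
      have h1 := hU.hasSum_linearIsometryEquiv_symm (hU.linearIsometryEquiv f)
      rw [LinearIsometryEquiv.symm_apply_apply] at h1
      have h2 : ∀ i, (V i).adjoint f = hU.linearIsometryEquiv f i := by
        intro i
        refine (h1.mapL (V i).adjoint).unique ?_
        convert hasSum_single i ?_ using 1
        · exact (hadj' i _).symm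
        · intro j hj
          exact hadj i j hj.symm _
      have h3 : (fun i => (V i ∘L (V i).adjoint) f) = fun i => U i (hU.linearIsometryEquiv f i) := by
        ext i
        change V i ((V i).adjoint f) = _
        rw [h2]
        rfl
      exact h3 ▸ h1

end HilbertSum

/-! ### Orthogonality relations -/

section Coefficients

variable {G : Type*} [Group G] [TopologicalSpace G] [IsTopologicalGroup G]
  [LocallyCompactSpace G] [SecondCountableTopology G] [MeasurableSpace G] [BorelSpace G]
  {α : Measure (G ⧸ Subgroup.center G)} {s : BorelSection G}
  {χ : Subgroup.center G →ₜ* Circle}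
  (μ : Measure G) [μ.IsHaarMeasure] [μ.IsMulRightInvariant] [α.IsHaarMeasure]
  {H : Type*} [NormedAddCommGroup H] [InnerProductSpace ℂ H] [CompleteSpace H]
  {π : G →* (H ≃ₗᵢ[ℂ] H)} (hcont : IsContinuousRep π) (hχ : IsCentralCharacter π χ)
  (hsq : IsSquareIntegrableModCenter α s π)

theorem W_apply (u v : H) : W μ hcont hχ hsq u v =
    toInd α s χ μ ⟨coeff π u v, coeff_mem hcont hχ hsq u v⟩ := rfl

theorem inner_toInd_W (f : covariantFun α s χ) (u v : H) :
    inner ℂ (toInd α s χ μ f) (W μ hcont hχ hsq u v) =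
      ∫ x, conj ((f : G → ℂ) (s x)) * coeff π u v (s x) ∂α :=
  inner_toInd α s χ μ _ _

theorem W_intertwines (u : H) (a : G) (v : H) :
    W μ hcont hχ hsq u (π a v) = inducedRep α s χ μ a (W μ hcont hχ hsq u v) := by
  rw [W_apply, W_apply, inducedRep_toInd]
  congr 1
  ext g
  change inner ℂ (π g u) (π a v) = inner ℂ (π (a⁻¹ * g) u) v
  rw [map_mul]
  change _ = inner ℂ (π a⁻¹ (π g u)) v
  rw [inner_rep_left π a⁻¹, inv_inv]

/-- The product `conj f₁ · f₂` of two covariant functions is invariant under the centre. -/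
theorem conj_mul_covariant {f₁ f₂ : G → ℂ}
    (h₁ : ∀ (g : G) (h : Subgroup.center G), f₁ (g * h) = (χ h⁻¹ : ℂ) * f₁ g)
    (h₂ : ∀ (g : G) (h : Subgroup.center G), f₂ (g * h) = (χ h⁻¹ : ℂ) * f₂ g)
    (g : G) (h : Subgroup.center G) : conj (f₁ (g * h)) * f₂ (g * h) = conj (f₁ g) * f₂ g := by
  have : conj (χ h⁻¹ : ℂ) * (χ h⁻¹ : ℂ) = 1 := by
    rw [← Circle.coe_inv_eq_conj, ← Circle.coe_mul, inv_mul_cancel, Circle.coe_one]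
  rw [h₁, h₂, map_mul]
  linear_combination (conj (f₁ g) * f₂ g) * this

theorem conj_coeff (u v : H) (g : G) : conj (coeff π u v g) = coeff π v u g⁻¹ := by
  rw [coeff, coeff, inner_conj_symm, inner_rep_left, inv_inv]

/-- The inversion symmetry of the coefficients, a consequence of unimodularity. -/
theorem inner_W_swap [α.IsInvInvariant] (u v u' v' : H) :
    inner ℂ (W μ hcont hχ hsq u v) (W μ hcont hχ hsq u' v') =
      inner ℂ (W μ hcont hχ hsq v' u') (W μ hcont hχ hsq v u) := by
  have := s.measurableInv
  rw [W_apply, W_apply μ hcont hχ hsq v', inner_toInd_W, inner_toInd_W, ← integral_inv_eq_self]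
  refine integral_congr_ae (Eventually.of_forall fun x => ?_)
  have hinv := s.apply_mk (F := fun g => conj (coeff π u v g) * coeff π u' v' g)
    (conj_mul_covariant (coeff_mem hcont hχ hsq u v).2.1 (coeff_mem hcont hχ hsq u' v').2.1)
    (s x)⁻¹
  rw [QuotientGroup.mk_inv, s.mk_apply] at hinv
  refine hinv.trans ?_
  simp only [conj_coeff, inv_inv]
  rw [mul_comm]

/-- The orthogonality relations, for a representation of formal degree one. -/
theorem inner_W_W [α.IsInvInvariant] (hirr : IsIrreducibleRep π)
    (hdeg : HasFormalDegreeOne α s π) (u v u' v' : H) :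
    inner ℂ (W μ hcont hχ hsq u v) (W μ hcont hχ hsq u' v') = inner ℂ u' u * inner ℂ v v' := by
  have hschur : ∀ u u' : H, ∃ c : ℂ, ∀ v v' : H,
      inner ℂ (W μ hcont hχ hsq u v) (W μ hcont hχ hsq u' v') = c * inner ℂ v v' := by
    intro u u'
    obtain ⟨c, hc⟩ := hirr.exists_eq_smul
      (A := (W μ hcont hχ hsq u).adjoint ∘L W μ hcont hχ hsq u') (fun g v => by
        change (W μ hcont hχ hsq u).adjoint (W μ hcont hχ hsq u' (π g v)) = _
        rw [W_intertwines, adjoint_intertwines (W_intertwines μ hcont hχ hsq u)]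
        rfl)
    refine ⟨c, fun v v' => ?_⟩
    rw [← ContinuousLinearMap.adjoint_inner_right, ← inner_smul_right, ← hc]
    rfl
  obtain ⟨a, b, ha, hb, hab⟩ := hdeg
  have hnorm : inner ℂ (W μ hcont hχ hsq a b) (W μ hcont hχ hsq a b) = 1 := by
    refine (inner_toInd_W μ hcont hχ hsq
      ⟨coeff π a b, coeff_mem hcont hχ hsq a b⟩ a b).trans ?_
    have : ∀ x, conj (coeff π a b (s x)) * coeff π a b (s x) =
        ((‖coeff π a b (s x)‖ ^ 2 : ℝ) : ℂ) := fun x => by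
      rw [RCLike.conj_mul]; push_cast; rfl
    simp only [this]
    rw [integral_complex_ofReal, hab, Complex.ofReal_one]
  have hself : ∀ x : H, ‖x‖ = 1 → inner ℂ x x = 1 := fun x hx => by
    rw [inner_self_eq_norm_sq_to_K, hx]; simp
  obtain ⟨c, hc⟩ := hschur a a
  have hc1 : c = 1 := by
    have := hc b b
    rw [hnorm, hself b hb, mul_one] at this
    exact this.symm
  -- swapping the roles of the arguments reduces the case of `u, u'` to that of `a, a`
  obtain ⟨d, hd⟩ := hschur u u'
  have hd1 : d = inner ℂ u' u := by
    have := hd a a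
    rw [inner_W_swap, hc, hc1, hself a ha, one_mul, mul_one] at this
    exact this.symm
  rw [hd, hd1]

/-! ### Right translations -/

/-- Right translation `(r(z) f)(g) = f(g z)` on functions. -/
def rightTranslate [α.IsMulRightInvariant] (z : G) (f : covariantFun α s χ) :
    covariantFun α s χ :=
  ⟨fun g => (f : G → ℂ) (g * z), by
    have hz : ∀ (g : G) (h : Subgroup.center G), g * (h : G) * z = g * z * h := fun g h => by
      rw [mul_assoc, mul_assoc, ← Subgroup.mem_center_iff.1 h.2 z]
    have hcov : ∀ (g : G) (h : Subgroup.center G),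
        (f : G → ℂ) (g * h * z) = (χ h⁻¹ : ℂ) * (f : G → ℂ) (g * z) := fun g h => by
      rw [hz, f.2.2.1]
    have hm : Measurable fun g => (f : G → ℂ) (g * z) := f.2.1.comp (measurable_mul_const z)
    refine ⟨hm, hcov, (hm.comp s.measurable).aestronglyMeasurable, ?_⟩
    have := s.measurableMul₂
    have hn : ∀ x, ‖(f : G → ℂ) (s x * z)‖ =
        ‖(f : G → ℂ) (s (x * (QuotientGroup.mk z : G ⧸ Subgroup.center G)))‖ := fun x => by
      have h := s.apply_mk (F := fun g => ‖(f : G → ℂ) g‖)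
        (fun g h => by rw [f.2.2.1, norm_mul, Circle.norm_coe, one_mul]) (s x * z)
      rw [QuotientGroup.mk_mul, s.mk_apply] at h
      exact h.symm
    rw [eLpNorm_congr_norm_ae (Eventually.of_forall hn)]
    exact (f.2.2.2.comp_measurePreserving (measurePreserving_mul_right α _)).2⟩

theorem inner_rightTranslate [α.IsMulRightInvariant] (z : G) (f₁ f₂ : covariantFun α s χ) :
    inner ℂ (toInd α s χ μ (rightTranslate z f₁)) (toInd α s χ μ (rightTranslate z f₂)) =
      inner ℂ (toInd α s χ μ f₁) (toInd α s χ μ f₂) := by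
  have := s.measurableMul₂
  rw [inner_toInd, inner_toInd, ← integral_mul_right_eq_self
    (fun x => conj ((f₁ : G → ℂ) (s x)) * (f₂ : G → ℂ) (s x))
    (QuotientGroup.mk z : G ⧸ Subgroup.center G)]
  refine integral_congr_ae (Eventually.of_forall fun x => ?_)
  have h := s.apply_mk (F := fun g => conj ((f₁ : G → ℂ) g) * (f₂ : G → ℂ) g)
    (conj_mul_covariant f₁.2.2.1 f₂.2.2.1) (s x * z)
  rw [QuotientGroup.mk_mul, s.mk_apply] at h
  exact h.symm

theorem norm_rightTranslate [α.IsMulRightInvariant] (z : G) (f : covariantFun α s χ) :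
    ‖toInd α s χ μ (rightTranslate z f)‖ = ‖toInd α s χ μ f‖ := by
  rw [@norm_eq_sqrt_re_inner ℂ, @norm_eq_sqrt_re_inner ℂ, inner_rightTranslate]

theorem rightTranslate_coeff [α.IsMulRightInvariant] (z : G) (u v : H) :
    toInd α s χ μ (rightTranslate z ⟨coeff π u v, coeff_mem hcont hχ hsq u v⟩) =
      W μ hcont hχ hsq (π z u) v := by
  rw [W_apply]
  congr 1
  ext g
  change inner ℂ (π (g * z) u) v = inner ℂ (π g (π z u)) v
  rw [map_mul]
  rfl

/-- The orthogonal complement of the coefficients is stable under right translations. -/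
theorem inner_rightTranslate_W_eq_zero [α.IsMulRightInvariant] {h : covariantFun α s χ}
    (hh : ∀ u v, inner ℂ (toInd α s χ μ h) (W μ hcont hχ hsq u v) = 0) (z : G) (u v : H) :
    inner ℂ (toInd α s χ μ (rightTranslate z h)) (W μ hcont hχ hsq u v) = 0 := by
  have : u = π z (π z⁻¹ u) := by
    change u = (π z * π z⁻¹) u
    rw [← map_mul]
    simp
  rw [this, ← rightTranslate_coeff, inner_rightTranslate]
  exact hh _ _

/-! ### Matrix coefficients of the right translations -/

theorem integral_norm_mul_norm_le {X : Type*} [MeasurableSpace X] {ν : Measure X} {a b : X → ℂ}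
    (ha : MemLp a 2 ν) (hb : MemLp b 2 ν) :
    ∫ x, ‖a x‖ * ‖b x‖ ∂ν ≤ (eLpNorm a 2 ν).toReal * (eLpNorm b 2 ν).toReal := by
  have h := real_inner_le_norm ha.norm.toLp hb.norm.toLp
  rw [L2.inner_def, Lp.norm_toLp, Lp.norm_toLp, eLpNorm_norm, eLpNorm_norm] at h
  refine le_trans (le_of_eq (integral_congr_ae ?_)) h
  filter_upwards [ha.norm.coeFn_toLp, hb.norm.coeFn_toLp] with x h1 h2
  rw [h1, h2, real_inner_eq_re_inner ℝ, RCLike.inner_apply]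
  simp [mul_comm]

/-- If, in the sense of the integrals below, `h` is orthogonal to all the functions
`g ↦ ⟨l(g) φ, f⟩`, then it is orthogonal to almost every right translate of `f`. Interchanging
the integrals, the hypothesis says that `Ψ(z) = ⟨h, r(z) f⟩` is orthogonal to every `φ`; the
truncations of `Ψ` to sets of finite measure are admissible choices of `φ`. -/
theorem ae_inner_rightTranslate_eq_zero [α.IsMulRightInvariant] (h f : covariantFun α s χ)
    (H0 : ∀ φ : covariantFun α s χ, ∫ y, conj ((h : G → ℂ) (s y)) *
      ∫ x, conj ((φ : G → ℂ) ((s y)⁻¹ * s x)) * (f : G → ℂ) (s x) ∂α ∂α = 0) :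
    ∀ᵐ x ∂α, inner ℂ (toInd α s χ μ h) (toInd α s χ μ (rightTranslate (s x) f)) = 0 := by
  set Ψ : G → ℂ := fun z => ∫ y, conj ((h : G → ℂ) (s y)) * (f : G → ℂ) (s y * z) ∂α with hΨ
  have hΨi : ∀ z, inner ℂ (toInd α s χ μ h) (toInd α s χ μ (rightTranslate z f)) = Ψ z :=
    fun z => inner_toInd α s χ μ _ _
  simp only [hΨi]
  have hhm : Measurable (h : G → ℂ) := h.2.1
  have hfm : Measurable (f : G → ℂ) := f.2.1
  have hfz : ∀ z, MemLp (fun y => (f : G → ℂ) (s y * z)) 2 α := fun z => (rightTranslate z f).2.2.2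
  set C : ℝ := ‖toInd α s χ μ h‖ * ‖toInd α s χ μ f‖ with hC
  have hC0 : 0 ≤ C := by positivity
  have hbound : ∀ z, ∫ y, ‖(h : G → ℂ) (s y)‖ * ‖(f : G → ℂ) (s y * z)‖ ∂α ≤ C := by
    intro z
    refine (integral_norm_mul_norm_le h.2.2.2 (hfz z)).trans (le_of_eq ?_)
    rw [hC, ← norm_rightTranslate μ z f, norm_toInd, norm_toInd]
    rfl
  have hΨb : ∀ z, ‖Ψ z‖ ≤ C := fun z => by
    refine (norm_integral_le_integral_norm _).trans (le_trans (le_of_eq ?_) (hbound z))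
    simp only [norm_mul, RCLike.norm_conj]
  have hΨm : Measurable Ψ := by
    refine StronglyMeasurable.measurable (StronglyMeasurable.integral_prod_right
      (f := fun z y => conj ((h : G → ℂ) (s y)) * (f : G → ℂ) (s y * z)) ?_)
    refine Measurable.stronglyMeasurable ?_
    exact ((Complex.continuous_conj.measurable.comp hhm).comp (s.measurable.comp measurable_snd)).mul
      (hfm.comp ((s.measurable.comp measurable_snd).mul measurable_fst))
  have hΨc : ∀ (z : G) (k : Subgroup.center G), Ψ (z * k) = (χ k⁻¹ : ℂ) * Ψ z := by
    intro z k
    simp only [hΨ, ← mul_assoc, f.2.2.1]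
    rw [← integral_const_mul]
    refine integral_congr_ae (Eventually.of_forall fun y => ?_)
    ring
  refine ae_of_forall_measure_lt_top_ae_restrict _ fun A hA hAα => ?_
  -- the test function is `Ψ` cut off to the preimage of `A`, so that `⟨φ, Ψ⟩ = ∫_A |Ψ ∘ s|²`
  set φ : G → ℂ := fun g => A.indicator (fun _ => (1 : ℂ)) (QuotientGroup.mk g) * Ψ g with hφ
  have hφs : ∀ x, φ (s x) = A.indicator (fun x => Ψ (s x)) x := fun x => by
    simp only [hφ, s.mk_apply]
    by_cases hx : x ∈ A <;> simp [hx]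
  have hφm : Measurable φ :=
    ((measurable_const.indicator hA).comp measurable_quotient_mk).mul hΨm
  have hfin : IsFiniteMeasure (α.restrict A) := ⟨by simpa using hAα⟩
  have hφLp : ∀ p, MemLp (fun x => φ (s x)) p α := fun p => by
    simp only [hφs]
    exact (memLp_indicator_iff_restrict hA).2 (MemLp.of_bound
      (hΨm.comp s.measurable).aestronglyMeasurable C (Eventually.of_forall fun x => hΨb _))
  have hφc : ∀ (g : G) (k : Subgroup.center G), φ (g * k) = (χ k⁻¹ : ℂ) * φ g := fun g k => by
    simp only [hφ, hΨc, QuotientGroup.mk_mul_of_mem g k.2]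
    ring
  have h0 := H0 ⟨φ, hφm, hφc, hφLp 2⟩
  -- the inner integral is translated by `y`
  have h1 : ∀ y, ∫ x, conj (φ ((s y)⁻¹ * s x)) * (f : G → ℂ) (s x) ∂α =
      ∫ z, conj (φ (s z)) * (f : G → ℂ) (s y * s z) ∂α := by
    intro y
    have := s.measurableMul₂
    rw [← integral_mul_left_eq_self _ y]
    refine integral_congr_ae (Eventually.of_forall fun z => ?_)
    have h := s.apply_mk (F := fun g => conj (φ ((s y)⁻¹ * g)) * (f : G → ℂ) g)
      (fun g k => by
        exact conj_mul_covariant (χ := χ) (f₁ := fun g => φ ((s y)⁻¹ * g)) (f₂ := f)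
          (fun g k => by rw [← mul_assoc, hφc]) f.2.2.1 g k) (s y * s z)
    rw [QuotientGroup.mk_mul, s.mk_apply, s.mk_apply] at h
    refine h.trans ?_
    simp
  simp only [h1, ← integral_const_mul] at h0
  have hint : Integrable (Function.uncurry fun y z => conj ((h : G → ℂ) (s y)) *
      (conj (φ (s z)) * (f : G → ℂ) (s y * s z))) (α.prod α) := by
    have hm : Measurable (Function.uncurry fun y z => conj ((h : G → ℂ) (s y)) *
        (conj (φ (s z)) * (f : G → ℂ) (s y * s z))) :=
      ((Complex.continuous_conj.measurable.comp hhm).comp (s.measurable.comp measurable_fst)).mul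
        (((Complex.continuous_conj.measurable.comp hφm).comp (s.measurable.comp measurable_snd)).mul
          (hfm.comp ((s.measurable.comp measurable_fst).mul (s.measurable.comp measurable_snd))))
    have hn : ∀ y z, ‖conj ((h : G → ℂ) (s y)) * (conj (φ (s z)) * (f : G → ℂ) (s y * s z))‖ =
        ‖φ (s z)‖ * (‖(h : G → ℂ) (s y)‖ * ‖(f : G → ℂ) (s y * s z)‖) := fun y z => by
      simp only [norm_mul, RCLike.norm_conj]
      ring
    refine (integrable_prod_iff' hm.aestronglyMeasurable).2 ⟨Eventually.of_forall fun z => ?_, ?_⟩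
    · have h2 : Integrable (fun y => ‖φ (s z)‖ *
          (‖(h : G → ℂ) (s y)‖ * ‖(f : G → ℂ) (s y * s z)‖)) α :=
        (MemLp.integrable_mul h.2.2.2.norm (hfz (s z)).norm).const_mul _
      refine h2.mono' (hm.comp (measurable_id.prodMk measurable_const)).aestronglyMeasurable
        (Eventually.of_forall fun y => (hn y z).le)
    · simp only [Function.uncurry_apply_pair, hn, integral_const_mul]
      refine Integrable.mono' (((memLp_one_iff_integrable.1 (hφLp 1)).norm).mul_const C) ?_
        (Eventually.of_forall fun z => ?_)
      · refine (Measurable.mul (hφm.comp s.measurable).norm ?_).aestronglyMeasurable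
        refine StronglyMeasurable.measurable (StronglyMeasurable.integral_prod_right
          (f := fun z y => ‖(h : G → ℂ) (s y)‖ * ‖(f : G → ℂ) (s y * s z)‖) ?_)
        refine Measurable.stronglyMeasurable ?_
        exact (hhm.comp (s.measurable.comp measurable_snd)).norm.mul
          (hfm.comp ((s.measurable.comp measurable_snd).mul
            (s.measurable.comp measurable_fst))).norm
      · rw [Real.norm_of_nonneg (mul_nonneg (norm_nonneg _)
          (integral_nonneg fun y => by positivity))]
        exact mul_le_mul_of_nonneg_left (hbound _) (norm_nonneg _)
  rw [integral_integral_swap hint] at h0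
  have h2 : ∀ z, ∫ y, conj ((h : G → ℂ) (s y)) * (conj (φ (s z)) * (f : G → ℂ) (s y * s z)) ∂α =
      A.indicator (fun z => ((‖Ψ (s z)‖ ^ 2 : ℝ) : ℂ)) z := by
    intro z
    have : ∫ y, conj ((h : G → ℂ) (s y)) * (conj (φ (s z)) * (f : G → ℂ) (s y * s z)) ∂α =
        conj (φ (s z)) * Ψ (s z) := by
      rw [hΨ, ← integral_const_mul]
      refine integral_congr_ae (Eventually.of_forall fun y => ?_)
      ring
    rw [this, hφs]
    by_cases hz : z ∈ A
    · simp only [Set.indicator_of_mem hz]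
      rw [RCLike.conj_mul]; push_cast; rfl
    · simp [hz]
  simp only [h2] at h0
  rw [integral_indicator hA, integral_complex_ofReal, Complex.ofReal_eq_zero] at h0
  have hΨint : Integrable (fun z => ‖Ψ (s z)‖ ^ 2) (α.restrict A) :=
    Integrable.of_bound (((hΨm.comp s.measurable).norm).pow_const 2).aestronglyMeasurable (C ^ 2)
      (Eventually.of_forall fun z => by
        rw [Real.norm_of_nonneg (by positivity)]
        exact pow_le_pow_left₀ (norm_nonneg _) (hΨb _) 2)
  rw [integral_eq_zero_iff_of_nonneg (fun z => by positivity) hΨint] at h0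
  filter_upwards [h0] with z hz
  simpa using hz

theorem secondCountableTopology_indSpace : SecondCountableTopology (IndSpace α s χ μ) := by
  have := s.countablyGenerated
  have : Fact ((2 : ℝ≥0∞) ≠ ∞) := ⟨by norm_num⟩
  have : SecondCountableTopology (Lp ℂ 2 α) := inferInstance
  exact (JIso α s χ μ).toHomeomorph.secondCountableTopology

/-- Every intertwining operator from `π` to the induced representation takes its values in the
closed span of the coefficients of `π`. A vector `T v` represented by `f` satisfies
`⟨l(g) φ, f⟩ = c_{T* φ, v}(g)`, so almost every right translate of `f` is orthogonal to the
orthogonal complement of the coefficients; by separability one right translate will do for the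
whole complement, and the complement is stable under right translations. -/
theorem inner_intertwiner_eq_zero [α.IsMulRightInvariant] {T : H →L[ℂ] IndSpace α s χ μ}
    (hT : ∀ g v, T (π g v) = inducedRep α s χ μ g (T v)) {h : IndSpace α s χ μ}
    (hh : ∀ u v, inner ℂ h (W μ hcont hχ hsq u v) = 0) (v : H) : inner ℂ h (T v) = 0 := by
  obtain ⟨f, hf⟩ := toInd_surjective α s χ μ (T v)
  let N : Set (IndSpace α s χ μ) := {k | ∀ u v, inner ℂ k (W μ hcont hχ hsq u v) = 0}
  have hae : ∀ k ∈ N, ∀ᵐ x ∂α,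
      inner ℂ k (toInd α s χ μ (rightTranslate (s x) f)) = 0 := by
    intro k hk
    obtain ⟨k, rfl⟩ := toInd_surjective α s χ μ k
    refine ae_inner_rightTranslate_eq_zero μ k f fun φ => ?_
    have h1 : ∀ g : G, coeff π (T.adjoint (toInd α s χ μ φ)) v g =
        ∫ x, conj ((φ : G → ℂ) (g⁻¹ * s x)) * (f : G → ℂ) (s x) ∂α := by
      intro g
      rw [coeff, ← adjoint_intertwines hT, ContinuousLinearMap.adjoint_inner_left, ← hf,
        inducedRep_toInd, inner_toInd]
      rfl
    have h2 := hk (T.adjoint (toInd α s χ μ φ)) v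
    rw [inner_toInd_W] at h2
    simpa only [h1] using h2
  have := secondCountableTopology_indSpace (α := α) (s := s) (χ := χ) μ
  obtain ⟨D, hDc, hDd⟩ := TopologicalSpace.exists_countable_dense N
  have hall : ∀ᵐ x ∂α, ∀ k ∈ D,
      inner ℂ (k : IndSpace α s χ μ) (toInd α s χ μ (rightTranslate (s x) f)) = 0 :=
    (ae_ball_iff hDc).2 fun k _ => hae k k.2
  obtain ⟨x, hx⟩ := hall.exists
  have hN : ∀ k : N,
      inner ℂ (k : IndSpace α s χ μ) (toInd α s χ μ (rightTranslate (s x) f)) = 0 := by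
    refine isClosed_property hDd.denseRange_val ?_ fun k => hx k k.2
    exact isClosed_eq (continuous_subtype_val.inner continuous_const) continuous_const
  obtain ⟨h, rfl⟩ := toInd_surjective α s χ μ h
  rw [← hf, ← inner_rightTranslate μ (s x)]
  exact hN ⟨_, inner_rightTranslate_W_eq_zero μ hcont hχ hsq hh (s x)⟩

end Coefficients

/-! ### Isotypic representations -/

section Isotypic

universe w

variable {G : Type*} [Group G] {H : Type*} [NormedAddCommGroup H] [InnerProductSpace ℂ H]

/-- The transport of a unitary representation along a unitary operator. -/
def conjRep {K : Type*} [NormedAddCommGroup K] [InnerProductSpace ℂ K] (E : H ≃ₗᵢ[ℂ] K)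
    (π : G →* (H ≃ₗᵢ[ℂ] H)) : G →* (K ≃ₗᵢ[ℂ] K) where
  toFun g := (E.symm.trans (π g)).trans E
  map_one' := by ext v; simp
  map_mul' g g' := by ext v; simp

theorem conjRep_apply {K : Type*} [NormedAddCommGroup K] [InnerProductSpace ℂ K]
    (E : H ≃ₗᵢ[ℂ] K) (π : G →* (H ≃ₗᵢ[ℂ] H)) (g : G) (v : K) :
    conjRep E π g v = E (π g (E.symm v)) := rfl

theorem IsIrreducibleRep.conjRep {K : Type*} [NormedAddCommGroup K] [InnerProductSpace ℂ K]
    {π : G →* (H ≃ₗᵢ[ℂ] H)} (hirr : IsIrreducibleRep π) (E : H ≃ₗᵢ[ℂ] K) :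
    IsIrreducibleRep (conjRep E π) := by
  have := hirr.1
  refine ⟨E.symm.toEquiv.nontrivial, fun V hV hinv => ?_⟩
  have hE : ∀ {v : H}, v ∈ V.comap (E.toLinearEquiv : H →ₗ[ℂ] K) ↔ E v ∈ V := Iff.rfl
  rcases hirr.2 (V.comap (E.toLinearEquiv : H →ₗ[ℂ] K)) (hV.preimage E.continuous)
    (fun g v hv => by
      have h := hinv g (E v) hv
      rw [conjRep_apply, E.symm_apply_apply] at h
      exact h) with h | h
  · left
    refine (Submodule.eq_bot_iff _).2 fun v hv => ?_
    have hv' : E.symm v ∈ V.comap (E.toLinearEquiv : H →ₗ[ℂ] K) :=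
      hE.2 (by rwa [E.apply_symm_apply])
    rw [h, Submodule.mem_bot] at hv'
    simpa using hv'
  · right
    refine (Submodule.eq_top_iff').2 fun v => ?_
    have hv' : E.symm v ∈ V.comap (E.toLinearEquiv : H →ₗ[ℂ] K) := h ▸ Submodule.mem_top
    simpa using hE.1 hv'

/-- A Hilbert sum of copies of an irreducible representation is isotypic, whatever the universes
of the irreducible representation and of the index type: the representation is transported to
the range of one copy, and the index type embeds into the space by a non-zero vector. -/
theorem isIsotypicRep_of_isHilbertSum [TopologicalSpace G] [CompleteSpace H] {K : Type w}
    [NormedAddCommGroup K] [InnerProductSpace ℂ K] [CompleteSpace K] {ρ : G →* (K ≃ₗᵢ[ℂ] K)}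
    {π : G →* (H ≃ₗᵢ[ℂ] H)} {ι : Type*} [Nonempty ι] (T : ι → H →ₗᵢ[ℂ] K)
    (hcont : IsContinuousRep π) (hirr : IsIrreducibleRep π)
    (hT : ∀ i g v, T i (π g v) = ρ g (T i v)) (hsum : IsHilbertSum ℂ (fun _ : ι => H) T) :
    IsIsotypicRep ρ := by
  obtain ⟨i₀⟩ := ‹Nonempty ι›
  have := hirr.1
  obtain ⟨x₀, hx₀⟩ := exists_ne (0 : H)
  have horth : ∀ i j, i ≠ j → ∀ x y, inner ℂ (T i x) (T j y) = 0 :=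
    fun i j hij x y => hsum.OrthogonalFamily hij x y
  have hinj : Function.Injective fun i => T i x₀ := by
    intro i j hij
    by_contra hne
    have h := horth i j hne x₀ x₀
    simp only at hij
    rw [← hij, inner_self_eq_zero, ← map_zero (T i)] at h
    exact hx₀ ((T i).injective h)
  have : Small.{w} ι := small_of_injective hinj
  let E := (T i₀).equivRange
  have hcomplete : CompleteSpace (LinearMap.range (T i₀).toLinearMap) :=
    E.toIsometryEquiv.completeSpace_iff.1 inferInstance
  refine ⟨LinearMap.range (T i₀).toLinearMap, inferInstance, inferInstance, hcomplete,
    conjRep E π, Shrink.{w} ι, fun i => (T ((equivShrink ι).symm i)).comp E.symm.toLinearIsometry,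
    fun v => E.continuous.comp (hcont _), hirr.conjRep E, fun i g v => ?_,
    isHilbertSum_of_total (fun i j hij x y => ?_) fun f hf => ?_⟩
  · change T _ (E.symm (conjRep E π g v)) = ρ g (T _ (E.symm v))
    rw [conjRep_apply, E.symm_apply_apply, hT]
  · exact horth _ _ (fun h => hij ((equivShrink ι).symm.injective h)) _ _
  · refine total_of_isHilbertSum hsum fun i x => ?_
    have h := hf (equivShrink ι i) (E x)
    change inner ℂ (T ((equivShrink ι).symm (equivShrink ι i)) (E.symm (E x))) f = 0 at h
    rwa [Equiv.symm_apply_apply, E.symm_apply_apply] at h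

end Isotypic

/-! ### Density of the coefficients -/

section Main

variable {G : Type*} [Group G] [TopologicalSpace G] [IsTopologicalGroup G]
  [LocallyCompactSpace G] [SecondCountableTopology G] [MeasurableSpace G] [BorelSpace G]
  {α : Measure (G ⧸ Subgroup.center G)} {s : BorelSection G}
  {χ : Subgroup.center G →ₜ* Circle}
  (μ : Measure G) [μ.IsHaarMeasure] [μ.IsMulRightInvariant] [α.IsHaarMeasure]
  {H : Type*} [NormedAddCommGroup H] [InnerProductSpace ℂ H] [CompleteSpace H]
  {π : G →* (H ≃ₗᵢ[ℂ] H)} (hcont : IsContinuousRep π) (hχ : IsCentralCharacter π χ)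
  (hsq : IsSquareIntegrableModCenter α s π)

/-- If the induced representation is isotypic, the coefficients of `π` span a dense subspace: the
irreducible constituent is, up to a dense range, an image of `π`, so all its copies lie in the
closed span of the coefficients. -/
theorem eq_zero_of_isIsotypicRep [α.IsMulRightInvariant]
    (hiso : IsIsotypicRep (inducedRep α s χ μ)) {u v : H} (huv : W μ hcont hχ hsq u v ≠ 0)
    {f : IndSpace α s χ μ} (hf : ∀ u v, inner ℂ f (W μ hcont hχ hsq u v) = 0) : f = 0 := by
  obtain ⟨K, _, _, _, σ, κ, T, -, hσ, hT, hsum⟩ := hiso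
  let T' : κ → K →L[ℂ] IndSpace α s χ μ := fun i => (T i).toContinuousLinearMap
  have hT' : ∀ i g v, T' i (σ g v) = inducedRep α s χ μ g (T' i v) := hT
  -- some copy of `σ` is not orthogonal to `c_{u,v}`
  obtain ⟨i, hi⟩ : ∃ i, (T' i).adjoint (W μ hcont hχ hsq u v) ≠ 0 := by
    by_contra! hall
    refine huv (total_of_isHilbertSum hsum fun i x => ?_)
    change inner ℂ (T' i x) _ = 0
    rw [← ContinuousLinearMap.adjoint_inner_right, hall, inner_zero_right]
  let S : H →L[ℂ] K := (T' i).adjoint ∘L W μ hcont hχ hsq u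
  have hS : ∀ g v, S (π g v) = σ g (S v) := fun g v => by
    change (T' i).adjoint (W μ hcont hχ hsq u (π g v)) = _
    rw [W_intertwines, adjoint_intertwines (hT' i)]
    rfl
  have hdense := hσ.closure_range_eq_top hS hi
  refine total_of_isHilbertSum hsum fun j x => inner_eq_zero_symm.1 ?_
  have hx : x ∈ closure (LinearMap.range (S : H →ₗ[ℂ] K) : Set K) := by
    rw [← Submodule.topologicalClosure_coe, hdense]
    trivial
  refine closure_minimal (t := {x | inner ℂ f (T j x) = 0}) ?_ ?_ hx
  · rintro _ ⟨w, rfl⟩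
    exact inner_intertwiner_eq_zero μ hcont hχ hsq (T := T' j ∘L S) (fun g v => by
      change T' j (S (π g v)) = _
      rw [hS, hT']
      rfl) hf w
  · exact isClosed_eq (continuous_const.inner (T j).continuous) continuous_const

/-- Orthogonality to the coefficients `c_{u,v}` need only be tested for `u` in a Hilbert basis. -/
theorem inner_W_eq_zero_of_hilbertBasis [α.IsInvInvariant] (hirr : IsIrreducibleRep π)
    (hdeg : HasFormalDegreeOne α s π) {ι : Type*} (e : HilbertBasis ι ℂ H)
    {f : IndSpace α s χ μ} (hf : ∀ i v, inner ℂ (W μ hcont hχ hsq (e i) v) f = 0) (u v : H) :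
    inner ℂ f (W μ hcont hχ hsq u v) = 0 := by
  have hadd : ∀ u u', W μ hcont hχ hsq (u + u') v =
      W μ hcont hχ hsq u v + W μ hcont hχ hsq u' v := fun u u' => by
    simp only [W_apply, ← map_add]
    congr 1
    ext g
    simp [coeff]
  have hsmul : ∀ (c : ℂ) u, W μ hcont hχ hsq (c • u) v =
      conj c • W μ hcont hχ hsq u v := fun c u => by
    simp only [W_apply, ← map_smul]
    congr 1
    ext g
    simp [coeff, mul_comm]
  let B : H →ₗ⋆[ℂ] IndSpace α s χ μ :=
    { toFun := fun u => W μ hcont hχ hsq u v, map_add' := hadd, map_smul' := hsmul }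
  have hB : Continuous B := by
    refine AddMonoidHomClass.continuous_of_bound B ‖v‖ fun u => le_of_eq ?_
    change ‖W μ hcont hχ hsq u v‖ = _
    have h := inner_W_W μ hcont hχ hsq hirr hdeg u v u v
    simp only [inner_self_eq_norm_sq_to_K] at h
    have h' : ‖W μ hcont hχ hsq u v‖ ^ 2 = (‖v‖ * ‖u‖) ^ 2 := by
      rw [mul_pow, mul_comm]
      exact_mod_cast h
    exact (sq_eq_sq₀ (norm_nonneg _) (by positivity)).1 h'
  have hclosed : IsClosed {u | inner ℂ f (B u) = 0} :=
    isClosed_eq (continuous_const.inner hB) continuous_const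
  have hu : u ∈ closure (Submodule.span ℂ (Set.range e) : Set H) := by
    rw [← Submodule.topologicalClosure_coe, e.dense_span]
    trivial
  refine closure_minimal (fun x hx => ?_) hclosed hu
  refine Submodule.span_induction (p := fun x _ => inner ℂ f (B x) = 0) ?_ ?_ ?_ ?_ hx
  · rintro _ ⟨i, rfl⟩
    exact inner_eq_zero_symm.1 (hf i v)
  · simp
  · intro x y _ _ hx hy
    rw [map_add, inner_add_right, hx, hy, add_zero]
  · intro c x _ hx
    rw [map_smulₛₗ, inner_smul_right, hx, mul_zero]

end Main

end PhaseSpace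

theorem mainTheorem1
    {G : Type*} [Group G] [TopologicalSpace G] [IsTopologicalGroup G] [T2Space G]
    [LocallyCompactSpace G] [SecondCountableTopology G] [MeasurableSpace G] [BorelSpace G]
    (μ : Measure G) [μ.IsHaarMeasure] [μ.IsMulRightInvariant]
    (α : Measure (G ⧸ Subgroup.center G)) [α.IsHaarMeasure]
    (s : PhaseSpace.BorelSection G)
    {H : Type*} [NormedAddCommGroup H] [InnerProductSpace ℂ H] [CompleteSpace H]
    [TopologicalSpace.SeparableSpace H]
    (π : G →* (H ≃ₗᵢ[ℂ] H)) (χ : Subgroup.center G →ₜ* Circle)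
    (hcont : PhaseSpace.IsContinuousRep π) (hirr : PhaseSpace.IsIrreducibleRep π)
    (hχ : PhaseSpace.IsCentralCharacter π χ)
    (hsq : PhaseSpace.IsSquareIntegrableModCenter α s π)
    (hdeg : PhaseSpace.HasFormalDegreeOne α s π)
    {ι : Type*} (e : HilbertBasis ι ℂ H) :
    (∀ i, IsStarProjection (PhaseSpace.W μ hcont hχ hsq (e i) ∘L
      (PhaseSpace.W μ hcont hχ hsq (e i)).adjoint)) ∧
    (PhaseSpace.IsResolutionOfIdentity (fun i => PhaseSpace.W μ hcont hχ hsq (e i) ∘L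
        (PhaseSpace.W μ hcont hχ hsq (e i)).adjoint) ↔
      PhaseSpace.IsIsotypicRep (PhaseSpace.inducedRep α s χ μ)) := by
  have hright := PhaseSpace.isMulRightInvariant_quotient μ α s
  have hinv := PhaseSpace.isInvInvariant_quotient α s
  have hW : ∀ i x y, inner ℂ (PhaseSpace.W μ hcont hχ hsq (e i) x)
      (PhaseSpace.W μ hcont hχ hsq (e i) y) = inner ℂ x y := fun i x y => by
    rw [PhaseSpace.inner_W_W μ hcont hχ hsq hirr hdeg, inner_self_eq_norm_sq_to_K,
      e.orthonormal.1 i]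
    simp
  have horth : ∀ i j, i ≠ j → ∀ x y, inner ℂ (PhaseSpace.W μ hcont hχ hsq (e i) x)
      (PhaseSpace.W μ hcont hχ hsq (e j) y) = 0 := fun i j hij x y => by
    rw [PhaseSpace.inner_W_W μ hcont hχ hsq hirr hdeg, e.orthonormal.2 hij.symm, zero_mul]
  refine ⟨fun i => PhaseSpace.isStarProjection_comp_adjoint (hW i), ?_⟩
  rw [PhaseSpace.isResolutionOfIdentity_iff_total hW horth]
  have := hirr.1
  obtain ⟨v, hv⟩ := exists_ne (0 : H)
  have hne : Nonempty ι := by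
    by_contra hempty
    rw [not_nonempty_iff] at hempty
    exact hv ((e.hasSum_repr v).unique hasSum_empty)
  constructor
  · intro htot
    exact PhaseSpace.isIsotypicRep_of_isHilbertSum
      (fun i => LinearMap.isometryOfInner
        (PhaseSpace.W μ hcont hχ hsq (e i) : H →ₗ[ℂ] PhaseSpace.IndSpace α s χ μ) (hW i))
      hcont hirr (fun i => PhaseSpace.W_intertwines μ hcont hχ hsq (e i))
      (PhaseSpace.isHilbertSum_of_total horth htot)
  · intro hiso f hf
    obtain ⟨i⟩ := hne
    have hWv : PhaseSpace.W μ hcont hχ hsq (e i) v ≠ 0 := fun h => hv (by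
      have h' := hW i v v
      rw [h, inner_zero_left] at h'
      exact inner_self_eq_zero.1 h'.symm)
    exact PhaseSpace.eq_zero_of_isIsotypicRep μ hcont hχ hsq hiso hWv
      (PhaseSpace.inner_W_eq_zero_of_hilbertBasis μ hcont hχ hsq hirr hdeg e hf)
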